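/- Let $n\ge 4$, and let $\Gamma$ be the Cayley graph of the symmetric group $S_n$ with generators $(1\,2)$, $(1\,2\,\dots\,n)$ and $(1\,n\,\dots\,2)=(1\,2\,\dots\,n)^{-1}$: its vertices are the permutations in $S_n$, and $\pi$ is joined to $\pi g$ by an edge of weight one for every generator $g$. Let the distance of two permutations be the length of a shortest path in $\Gamma$ between them. Then the diameter of $\Gamma$, i.e. the greatest distance between two elements of $S_n$, satisfies $$\operatorname{diam}(\Gamma)\ \ge\ \frac{n(n-1)}{2}.$$ -/

import Mathlib

/-- The generating set `{(1 2), (1 2 … n), (1 n … 2)}` of the symmetric group on `n ≥ 2` letters.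
The letters `1, …, n` are represented by the elements `0, …, n - 1` of `Fin n`, and
`finRotate n` is the cycle sending `i` to `i + 1` and the last letter to the first. -/
def lrxGenerators (n : ℕ) (hn : 2 ≤ n) : Set (Equiv.Perm (Fin n)) :=
  {Equiv.swap ⟨0, by omega⟩ ⟨1, by omega⟩, finRotate n, (finRotate n)⁻¹}

/-- The Cayley graph of the symmetric group on `n ≥ 2` letters with generators
`(1 2), (1 2 … n), (1 n … 2)`: a permutation `p` is joined to `p * g` for each generator `g`,
every edge having weight one. -/
def lrxCayleyGraph (n : ℕ) (hn : 2 ≤ n) : SimpleGraph (Equiv.Perm (Fin n)) :=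
  SimpleGraph.mulCayley (lrxGenerators n hn)

/-! The permutation far from the identity is the reflection `i ↦ 1 - i` of the circle of positions.
A word for it is run on tokens placed at the integers, the lift of the circle, so that each token
acquires a winding number `c i`. Transpositions and rotations are then bounded separately.

Two tokens pass each other only at a transposition, and tokens whose windings have equal parity must
pass an odd number of times. So there are at least as many transpositions as pairs with equal
winding parity (`sq_add_sq_le_swapCount`); this is least when the parities are balanced.

For rotations, use the frame that turns with the word and glue the two places that are swapped
(`squeeze`). Transpositions become invisible, and a rotation moves one token by one step. A token
that starts at `s`, is at `y` after a prefix `v` and ends at `e` travels at least `|2y - s - e|`,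
and `s + e` is the same for all tokens up to multiples of `n - 1`. After `v` the tokens fill all
places, so the sum of the distances of `2y - s - e` from these multiples depends only on `rot w - 2
* rot v`. A prefix with a favourable value exists by `exists_append_abs_eq`.

The two bounds add up to the claim or to one less; parity, through the sign of the reflection,
supplies the missing unit. For `n = 2h + 1` with `rot w` and `h` of opposite parity the two counts
compete for the winding parities, and a penalty for even windings couples them. -/

namespace LRX

/-! ### Words and their action on the lifted circle -/

/-- The generators of the LRX graph: the transposition and the two rotations. -/
inductive Letter
  | swap
  | left
  | right

/-- The action of a generator on the integers, which lift the `n` positions on a circle. -/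
def act (n : ℕ) : Letter → ℤ → ℤ
  | .swap, y => if (n : ℤ) ∣ y then y + 1 else if (n : ℤ) ∣ y - 1 then y - 1 else y
  | .left, y => y - 1
  | .right, y => y + 1

/-- The rotation effected by a generator. -/
def Letter.shift : Letter → ℤ
  | .swap => 0
  | .left => -1
  | .right => 1

/-- The number of transpositions in a one-letter word. -/
def Letter.swaps : Letter → ℤ
  | .swap => 1
  | .left => 0
  | .right => 0

/-- The action of a word on the integers. -/
def run (n : ℕ) : List Letter → ℤ → ℤ
  | [], y => y
  | l :: w, y => run n w (act n l y)

/-- The total rotation of a word. -/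
def rot (w : List Letter) : ℤ := (w.map Letter.shift).sum

/-- The number of transpositions in a word. -/
def swapCount (w : List Letter) : ℤ := (w.map Letter.swaps).sum

/-- The number of rotations in a word. -/
def moveCount (w : List Letter) : ℤ := (w.map fun l => |l.shift|).sum

@[simp] lemma rot_nil : rot [] = 0 := rfl
@[simp] lemma rot_cons (l : Letter) (w : List Letter) : rot (l :: w) = l.shift + rot w := by
  simp [rot]
@[simp] lemma rot_append (v w : List Letter) : rot (v ++ w) = rot v + rot w := by simp [rot]
@[simp] lemma swapCount_nil : swapCount [] = 0 := rfl
@[simp] lemma swapCount_cons (l : Letter) (w : List Letter) :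
    swapCount (l :: w) = l.swaps + swapCount w := by simp [swapCount]
@[simp] lemma moveCount_nil : moveCount [] = 0 := rfl
@[simp] lemma moveCount_cons (l : Letter) (w : List Letter) :
    moveCount (l :: w) = |l.shift| + moveCount w := by simp [moveCount]
@[simp] lemma moveCount_append (v w : List Letter) :
    moveCount (v ++ w) = moveCount v + moveCount w := by simp [moveCount]

lemma swapCount_add_moveCount (w : List Letter) : swapCount w + moveCount w = w.length := by
  induction w with
  | nil => simp
  | cons l w ih => cases l <;> simp [Letter.swaps, Letter.shift] <;> linarith

lemma even_moveCount_sub_rot (w : List Letter) : (2 : ℤ) ∣ moveCount w - rot w := by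
  induction w with
  | nil => simp
  | cons l w ih => cases l <;> simp [Letter.shift] <;> omega

lemma run_append (n : ℕ) (v w : List Letter) (y : ℤ) : run n (v ++ w) y = run n w (run n v y) := by
  induction v generalizing y with
  | nil => rfl
  | cons l v ih => exact ih _

lemma act_add (n : ℕ) (l : Letter) (y : ℤ) : act n l (y + n) = act n l y + n := by
  cases l
  · have h : (n : ℤ) ∣ y + n - 1 ↔ (n : ℤ) ∣ y - 1 := by
      rw [show y + n - 1 = y - 1 + n by ring, dvd_add_self_right]
    simp only [act, dvd_add_self_right, h]
    split_ifs <;> ring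
  · simp only [act]; ring
  · simp only [act]; ring

lemma run_add (n : ℕ) (w : List Letter) (y : ℤ) : run n w (y + n) = run n w y + n := by
  induction w generalizing y with
  | nil => rfl
  | cons l w ih => simp only [run, act_add, ih]

lemma act_swap_one {n : ℕ} (hn : 2 ≤ n) : act n .swap 1 = 0 := by
  have h : ¬ (n : ℤ) ∣ 1 := fun h => by have := Int.le_of_dvd one_pos h; omega
  simp [act, h]

lemma act_swap_self (n : ℕ) : act n .swap n = n + 1 := by simp [act]

lemma act_swap_of_lt {n : ℕ} {y : ℤ} (h1 : 1 < y) (h2 : y < n) : act n .swap y = y := by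
  have h : ¬ (n : ℤ) ∣ y := fun h => by have := Int.le_of_dvd (by omega) h; omega
  have h' : ¬ (n : ℤ) ∣ y - 1 := fun h => by have := Int.le_of_dvd (by omega) h; omega
  simp [act, h, h']

/-- A letter permutes the residues modulo `n`. -/
lemma sum_act {n : ℕ} (hn : 2 ≤ n) {f : ℤ → ℤ} (hf : Function.Periodic f (n : ℤ)) (l : Letter) :
    ∑ i ∈ Finset.range n, f (act n l (i + 1)) = ∑ i ∈ Finset.range n, f (i + 1) := by
  obtain ⟨m, rfl⟩ : ∃ m, n = m + 2 := ⟨n - 2, by omega⟩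
  cases l
  -- With representatives `1, …, n`, the inner places are fixed, while `1` goes to `0` and `n` goes
  -- to `n + 1`: modulo `n` these two are exchanged.
  · rw [Finset.sum_range_succ, Finset.sum_range_succ', Finset.sum_range_succ,
      Finset.sum_range_succ']
    have h1 : ∀ i ∈ Finset.range m, f (act (m + 2) .swap (((i + 1 : ℕ) : ℤ) + 1)) =
        f (((i + 1 : ℕ) : ℤ) + 1) := fun i hi => by
      rw [act_swap_of_lt] <;> have := Finset.mem_range.1 hi <;> push_cast <;> omega
    have h2 := act_swap_one hn
    have h3 := act_swap_self (m + 2)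
    have h4 := hf 1
    have h5 := hf 0
    rw [Finset.sum_congr rfl h1]
    push_cast at *
    rw [show (m : ℤ) + 1 + 1 = m + 2 by ring, h3]
    simp only [zero_add] at *
    rw [h2, h5, ← h4, show (1 : ℤ) + (m + 2) = m + 2 + 1 by ring]
    ring
  · conv_lhs => rw [Finset.sum_range_succ']
    conv_rhs => rw [Finset.sum_range_succ]
    have h5 := hf 0
    simp only [act]
    push_cast at *
    simp only [zero_add] at *
    rw [show (m : ℤ) + 1 + 1 = m + 2 by ring, h5]
    simp
  · conv_lhs => rw [Finset.sum_range_succ]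
    conv_rhs => rw [Finset.sum_range_succ']
    have h5 := hf 1
    simp only [act]
    push_cast at *
    rw [← h5, show (m : ℤ) + 1 + 1 + 1 = 1 + (m + 2) by ring]

/-- A word permutes the residues modulo `n`. -/
lemma sum_run {n : ℕ} (hn : 2 ≤ n) (w : List Letter) {f : ℤ → ℤ}
    (hf : Function.Periodic f (n : ℤ)) :
    ∑ i ∈ Finset.range n, f (run n w (i + 1)) = ∑ i ∈ Finset.range n, f (i + 1) := by
  induction w with
  | nil => rfl
  | cons l w ih =>
    rw [← ih]
    exact sum_act hn (f := fun y => f (run n w y)) (fun y => by simp only [run_add, hf _]) l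

lemma sum_act_sub {n : ℕ} (hn : 2 ≤ n) (l : Letter) :
    ∑ i ∈ Finset.range n, (act n l (i + 1) - (i + 1)) = n * l.shift := by
  cases l
  · obtain ⟨m, rfl⟩ : ∃ m, n = m + 2 := ⟨n - 2, by omega⟩
    rw [Finset.sum_range_succ, Finset.sum_range_succ']
    have h1 : ∀ i ∈ Finset.range m, act (m + 2) .swap (((i + 1 : ℕ) : ℤ) + 1) -
        (((i + 1 : ℕ) : ℤ) + 1) = 0 := fun i hi => by
      rw [act_swap_of_lt] <;> have := Finset.mem_range.1 hi <;> push_cast <;> omega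
    have h2 := act_swap_one hn
    have h3 := act_swap_self (m + 2)
    rw [Finset.sum_congr rfl h1]
    push_cast at *
    rw [show (m : ℤ) + 1 + 1 = m + 2 by ring, h3]
    simp [h2, Letter.shift]
  · simp [act, Letter.shift]
  · simp [act, Letter.shift]

lemma sum_run_sub {n : ℕ} (hn : 2 ≤ n) (w : List Letter) :
    ∑ i ∈ Finset.range n, (run n w (i + 1) - (i + 1)) = n * rot w := by
  induction w with
  | nil => simp [run]
  | cons l w ih =>
    have h := sum_act hn (f := fun y => run n w y - y)
      (fun y => by simp only [run_add]; ring) l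
    rw [rot_cons, mul_add, ← sum_act_sub hn l, ← ih, ← h, ← Finset.sum_add_distrib]
    exact Finset.sum_congr rfl fun i _ => by simp only [run]; ring

/-! ### Squeezed coordinates and the cost of rotations -/

/-- The map that identifies `n * k` with `n * k + 1` for every `k`. -/
def squeeze (n : ℕ) (y : ℤ) : ℤ := y - (y - 1) / n

lemma squeeze_add {n : ℕ} (hn : 0 < n) (y : ℤ) : squeeze n (y + n) = squeeze n y + (n - 1) := by
  have : (y + n - 1) / (n : ℤ) = (y - 1) / n + 1 := by
    rw [show y + n - 1 = y - 1 + n by ring, Int.add_ediv_of_dvd_right (dvd_refl _),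
      Int.ediv_self (by omega)]
  simp only [squeeze, this]; ring

lemma squeeze_add_mul {n : ℕ} (hn : 0 < n) (y k : ℤ) :
    squeeze n (y + n * k) = squeeze n y + (n - 1) * k := by
  have : (y + n * k - 1) / (n : ℤ) = (y - 1) / n + k := by
    rw [show y + n * k - 1 = y - 1 + n * k by ring, Int.add_mul_ediv_left _ _ (by omega)]
  simp only [squeeze, this]; ring

lemma squeeze_of_mem {n : ℕ} {y : ℤ} (h1 : 1 ≤ y) (h2 : y ≤ n) : squeeze n y = y := by
  rw [squeeze, Int.ediv_eq_zero_of_lt (by omega) (by omega), sub_zero]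

lemma squeeze_zero {n : ℕ} (hn : 2 ≤ n) : squeeze n 0 = 1 := by
  have h := squeeze_add (n := n) (by omega) 0
  rw [zero_add, squeeze_of_mem (by omega) le_rfl] at h
  linarith

lemma squeeze_self_add_one {n : ℕ} (hn : 2 ≤ n) : squeeze n (n + 1) = n := by
  have h := squeeze_add (n := n) (by omega) 1
  rw [squeeze_of_mem (y := 1) (by omega) (by omega), add_comm (1 : ℤ)] at h
  linarith

/-- Gluing the swapped places makes the transposition contribute nothing. A rotation changes every
squeezed coordinate by its shift, except for the one token that steps between two glued places: from
`1` to `0`, or from `n` to `n + 1`. -/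
lemma sum_abs_squeeze_act {n : ℕ} (hn : 2 ≤ n) (l : Letter) :
    ∑ i ∈ Finset.range n, |squeeze n (act n l (i + 1)) - l.shift - squeeze n (i + 1)| ≤
      |l.shift| := by
  have hsq : ∀ i ∈ Finset.range n, squeeze n ((i : ℤ) + 1) = i + 1 := fun i hi =>
    squeeze_of_mem (by omega) (by have := Finset.mem_range.1 hi; omega)
  cases l
  · refine (Finset.sum_eq_zero fun i hi => ?_).le
    have hi' := Finset.mem_range.1 hi
    rw [hsq i hi]
    rcases Nat.eq_zero_or_pos i with rfl | h0
    · simp [act_swap_one hn, squeeze_zero hn, Letter.shift]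
    · by_cases h : i + 1 = n
      · have h' : (i : ℤ) + 1 = n := by omega
        simp [h', act_swap_self, squeeze_self_add_one hn, Letter.shift]
      · rw [act_swap_of_lt (by omega) (by omega), hsq i hi]
        simp [Letter.shift]
  · have h : ∀ i ∈ Finset.range n, |squeeze n (act n .left (i + 1)) - Letter.left.shift -
        squeeze n (i + 1)| = if i = 0 then 1 else 0 := fun i hi => by
      have hi' := Finset.mem_range.1 hi
      rw [hsq i hi]
      split_ifs with h
      · subst h; simp [act, squeeze_zero hn, Letter.shift]
      · simp only [act, add_sub_cancel_right, Letter.shift]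
        rw [squeeze_of_mem (by omega) (by omega)]; simp
    rw [Finset.sum_congr rfl h, Finset.sum_ite_eq' (Finset.range n) 0]
    split_ifs <;> simp [Letter.shift]
  · have h : ∀ i ∈ Finset.range n, |squeeze n (act n .right (i + 1)) - Letter.right.shift -
        squeeze n (i + 1)| = if i = n - 1 then 1 else 0 := fun i hi => by
      have hi' := Finset.mem_range.1 hi
      rw [hsq i hi]
      split_ifs with h
      · have h' : (i : ℤ) + 1 = n := by omega
        simp [act, h', squeeze_self_add_one hn, Letter.shift]
      · simp only [act, Letter.shift]
        rw [squeeze_of_mem (by omega) (by omega)]; simp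
    rw [Finset.sum_congr rfl h, Finset.sum_ite_eq' (Finset.range n) (n - 1)]
    split_ifs <;> simp [Letter.shift]

/-- Every rotation moves the marker past one token only, and transpositions do not count. -/
lemma sum_abs_squeeze_run {n : ℕ} (hn : 2 ≤ n) (w : List Letter) :
    ∑ i ∈ Finset.range n, |squeeze n (run n w (i + 1)) - rot w - squeeze n (i + 1)| ≤
      moveCount w := by
  induction w with
  | nil => simp [run]
  | cons l w ih =>
    have h := sum_act hn (f := fun y => |squeeze n (run n w y) - rot w - squeeze n y|)
      (fun y => by simp only [run_add, squeeze_add (n := n) (by omega)]; congr 1; ring) l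
    have h' := sum_abs_squeeze_act hn l
    rw [moveCount_cons]
    refine le_trans ?_ (add_le_add h' (h.le.trans ih))
    rw [← Finset.sum_add_distrib]
    refine Finset.sum_le_sum fun i _ => ?_
    rw [rot_cons]
    refine le_trans (le_of_eq ?_) (abs_add_le _ _)
    simp only [run]; congr 1; ring

/-- The triangle inequality `|2y - e - s| ≤ |y - s| + |e - y|`, with each leg paid for by its own
part of the word. -/
lemma sum_abs_squeeze_run_run {n : ℕ} (hn : 2 ≤ n) (v w : List Letter) :
    ∑ i ∈ Finset.range n, |2 * (squeeze n (run n v (i + 1)) - rot v) -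
      (squeeze n (run n (v ++ w) (i + 1)) - rot (v ++ w)) - squeeze n (i + 1)| ≤
      moveCount (v ++ w) := by
  have h := sum_run hn v (f := fun y => |squeeze n (run n w y) - rot w - squeeze n y|)
      (fun y => by simp only [run_add, squeeze_add (n := n) (by omega)]; congr 1; ring)
  rw [moveCount_append]
  refine le_trans ?_ (add_le_add (sum_abs_squeeze_run hn v)
    (h.le.trans (sum_abs_squeeze_run hn w)))
  rw [← Finset.sum_add_distrib]
  refine Finset.sum_le_sum fun i _ => ?_
  refine le_trans (le_of_eq ?_) (abs_sub _ _)
  rw [run_append, rot_append]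
  congr 1; ring

/-! ### Passings of pairs of tokens and the cost of transpositions -/

lemma abs_ediv_act_swap_le {n : ℕ} (hn : 2 ≤ n) {i j : ℕ} (hi : i < n) (hj : j < n) :
    |(act n .swap (j + 1) - act n .swap (i + 1)) / (n : ℤ) - ((j + 1 : ℤ) - (i + 1)) / n| ≤
      (if i = 0 then if j = n - 1 then 1 else 0 else 0) +
        (if i = n - 1 then if j = 0 then 1 else 0 else 0) := by
  have hn0 : (0 : ℤ) < n := by omega
  have key : ∀ x k : ℤ, n * k ≤ x → x < n * k + n → x / (n : ℤ) = k := fun x k h1 h2 => by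
    have h := Int.add_mul_ediv_left (x - n * k) k (show (n : ℤ) ≠ 0 by omega)
    rw [sub_add_cancel, Int.ediv_eq_zero_of_lt (a := x - n * k) (by linarith) (by linarith),
      zero_add] at h
    exact h
  have hact : ∀ k : ℕ, k < n → act n .swap (k + 1) = k + 1 + (if k = n - 1 then 1 else 0) -
      (if k = 0 then 1 else 0) := fun k hk => by
    rcases Nat.eq_zero_or_pos k with rfl | h0
    · rw [if_neg (by omega)]; simp [act_swap_one hn]
    · by_cases h : k = n - 1
      · have h' : (k : ℤ) + 1 = n := by omega
        rw [h', act_swap_self, if_pos h, if_neg (by omega)]; ring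
      · rw [act_swap_of_lt (by omega) (by omega), if_neg h, if_neg (by omega)]; ring
  rw [hact i hi, hact j hj]
  rcases lt_or_ge j i with hij | hij
  · rw [key (j + 1 - (i + 1)) (-1) (by omega) (by omega)]
    -- The exchanged tokens: the difference `1 - n` becomes `0 - (n + 1)`, whose floor quotient by
    -- `n` drops from `-1` to `-2`.
    by_cases h : i = n - 1 ∧ j = 0
    · rw [key _ (-2) (by split_ifs <;> omega) (by split_ifs <;> omega)]
      simp [h.1, h.2]; split_ifs <;> norm_num
    · rw [key _ (-1) (by split_ifs <;> omega) (by split_ifs <;> omega)]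
      simp only [sub_self, abs_zero]; split_ifs <;> norm_num
  · rw [key (j + 1 - (i + 1)) 0 (by omega) (by omega)]
    by_cases h : i = 0 ∧ j = n - 1
    · rw [key _ 1 (by split_ifs <;> omega) (by split_ifs <;> omega)]
      simp [h.1, h.2]; split_ifs <;> norm_num
    · rw [key _ 0 (by split_ifs <;> omega) (by split_ifs <;> omega)]
      simp only [sub_self, abs_zero]; split_ifs <;> norm_num

/-- Rotations preserve all differences. The factor `2` appears because the pairs are ordered. -/
lemma sum_abs_ediv_act {n : ℕ} (hn : 2 ≤ n) (l : Letter) :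
    ∑ i ∈ Finset.range n, ∑ j ∈ Finset.range n,
      |(act n l (j + 1) - act n l (i + 1)) / (n : ℤ) - ((j + 1 : ℤ) - (i + 1)) / n| ≤
      2 * l.swaps := by
  cases l
  · refine (Finset.sum_le_sum fun i hi => Finset.sum_le_sum fun j hj =>
      abs_ediv_act_swap_le hn (Finset.mem_range.1 hi) (Finset.mem_range.1 hj)).trans ?_
    simp only [Finset.sum_add_distrib, Finset.sum_ite_irrel, Finset.sum_ite_eq',
      Finset.sum_const_zero, Finset.mem_range]
    split_ifs <;> simp [Letter.swaps]
  · simp [act, Letter.swaps]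
  · simp [act, Letter.swaps]

/-- Two tokens pass each other only by a transposition. -/
lemma sum_abs_ediv_run {n : ℕ} (hn : 2 ≤ n) (w : List Letter) :
    ∑ i ∈ Finset.range n, ∑ j ∈ Finset.range n,
      |(run n w (j + 1) - run n w (i + 1)) / (n : ℤ) - ((j + 1 : ℤ) - (i + 1)) / n| ≤
      2 * swapCount w := by
  have hn0 : (n : ℤ) ≠ 0 := by omega
  induction w with
  | nil => simp [run]
  | cons l w ih =>
    have hp : ∀ x y : ℤ, |(run n w (y + n) - run n w x) / (n : ℤ) - (y + n - x) / n| =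
        |(run n w y - run n w x) / (n : ℤ) - (y - x) / n| := fun x y => by
      rw [run_add, show ∀ a b c : ℤ, a + b - c = a - c + b by intros; ring,
        show ∀ a b c : ℤ, a + b - c = a - c + b by intros; ring,
        Int.add_ediv_of_dvd_right (dvd_refl _), Int.add_ediv_of_dvd_right (dvd_refl _)]
      congr 1; ring
    have hq : ∀ x y : ℤ, |(run n w y - run n w (x + n)) / (n : ℤ) - (y - (x + n)) / n| =
        |(run n w y - run n w x) / (n : ℤ) - (y - x) / n| := fun x y => by
      rw [run_add, ← sub_sub, ← sub_sub,
        Int.sub_ediv_of_dvd _ (dvd_refl _), Int.sub_ediv_of_dvd _ (dvd_refl _)]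
      congr 1; ring
    have h1 : ∀ x : ℤ, _ := fun x => sum_act hn
      (f := fun y => |(run n w y - run n w x) / (n : ℤ) - (y - x) / n|) (fun y => hp x y) l
    have h2 := sum_act hn (f := fun x => ∑ j ∈ Finset.range n,
      |(run n w (j + 1) - run n w x) / (n : ℤ) - (j + 1 - x) / n|)
      (fun x => Finset.sum_congr rfl fun j _ => hq x _) l
    rw [swapCount_cons, mul_add]
    refine le_trans ?_ (add_le_add (sum_abs_ediv_act hn l) (h2.le.trans ih))
    rw [← Finset.sum_add_distrib]
    refine Finset.sum_le_sum fun i _ => ?_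
    rw [← h1, ← Finset.sum_add_distrib]
    refine Finset.sum_le_sum fun j _ => ?_
    refine le_trans (le_of_eq ?_) (abs_add_le _ _)
    simp only [run]; congr 1; ring

/-! ### Prefixes with a prescribed rotation -/

lemma exists_append_rot_eq (w : List Letter) (m : ℤ)
    (h : 0 ≤ m ∧ m ≤ rot w ∨ rot w ≤ m ∧ m ≤ 0) : ∃ v u, w = v ++ u ∧ rot v = m := by
  induction w generalizing m with
  | nil => exact ⟨[], [], rfl, by simp at h ⊢; omega⟩
  | cons l w ih =>
    by_cases hm : m = 0
    · exact ⟨[], l :: w, rfl, by simp [hm]⟩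
    · obtain ⟨v, u, rfl, hv⟩ := ih (m - l.shift) (by
        rw [rot_cons] at h
        cases l <;> simp only [Letter.shift] at * <;> omega)
      exact ⟨l :: v, u, rfl, by rw [rot_cons, hv]; ring⟩

lemma run_eq_add_rot (n : ℕ) (w : List Letter) (y : ℤ)
    (h : ∀ v u, w = v ++ u → ¬ (n : ℤ) ∣ y + rot v ∧ ¬ (n : ℤ) ∣ y + rot v - 1) :
    run n w y = y + rot w := by
  induction w generalizing y with
  | nil => simp [run]
  | cons l w ih =>
    have h0 := h [] (l :: w) rfl
    simp only [rot_nil, add_zero] at h0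
    have hl : act n l y = y + l.shift := by
      cases l <;> simp [act, Letter.shift, h0.1, h0.2, ← sub_eq_add_neg]
    rw [run, ih, hl, rot_cons, add_assoc]
    rintro v u rfl
    simpa [hl, add_assoc] using h (l :: v) u rfl

/-- A word that reverses the circle has to visit the positions at a prescribed distance from
the centres of the reversal: otherwise two adjacent tokens would never move. -/
lemma exists_append_abs_eq {n : ℕ} (hn : 3 ≤ n) (w : List Letter)
    (hw : ∀ a : ℤ, (n : ℤ) ∣ run n w a - (1 - a)) (θ : ℤ) (h0 : 0 ≤ θ) (h2 : θ + 2 ≤ n)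
    (hθ : (2 : ℤ) ∣ rot w - θ) :
    ∃ v u, w = v ++ u ∧ (rot w - 2 * rot v = θ ∨ rot w - 2 * rot v = -θ) := by
  by_contra! hcon
  -- Along the prefixes, `rot w - 2 * rot v` runs from `rot w` to `-rot w` in steps of size at most
  -- `2` and keeps the parity of `θ`. It cannot reach absolute value `θ` or more without taking one
  -- of the values `±θ`.
  have key : ∀ v u, w = v ++ u → |rot w - 2 * rot v| < θ := by
    intro v u hvu
    by_contra! hge
    have h1 := hcon [] w rfl
    simp only [rot_nil, mul_zero, sub_zero] at h1
    by_cases hC : θ ≤ |rot w|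
    · obtain ⟨v', u', h, hv'⟩ := exists_append_rot_eq w
        (if 0 ≤ rot w then (rot w - θ) / 2 else (rot w + θ) / 2) (by
          rcases abs_cases (rot w) with h | h <;> split_ifs <;> omega)
      have := hcon v' u' h
      split_ifs at hv' <;> omega
    · obtain ⟨v', u', h, hv'⟩ := exists_append_rot_eq v
        (if 0 ≤ rot v then (rot w + θ) / 2 else (rot w - θ) / 2) (by
          rcases abs_cases (rot w) with h | h <;>
            rcases abs_cases (rot w - 2 * rot v) with h' | h' <;> split_ifs <;> omega)
      have := hcon v' (u' ++ u) (by rw [hvu, h, List.append_assoc])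
      split_ifs at hv' <;> omega
  -- By `key`, these two adjacent tokens stay among the places `2, …, n - 1` throughout, where no
  -- transposition acts. Keeping their order while being reflected would force `n ∣ 2`.
  have fixed : ∀ k : ℤ, k = 1 ∨ k = 2 →
      run n w ((θ - rot w) / 2 + k) = (θ - rot w) / 2 + k + rot w := by
    intro k hk
    refine run_eq_add_rot n w _ fun v u hvu => ?_
    have h := abs_lt.1 (key v u hvu)
    constructor <;> intro hd <;> have := Int.le_of_dvd (by omega) hd <;> omega
  have d1 := hw ((θ - rot w) / 2 + 1)
  have d2 := hw ((θ - rot w) / 2 + 2)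
  rw [fixed 1 (Or.inl rfl)] at d1
  rw [fixed 2 (Or.inr rfl)] at d2
  have := Int.le_of_dvd (by norm_num) ((dvd_sub d2 d1).trans (dvd_of_eq (b := 2) (by ring)))
  omega

/-! ### Distances from multiples and their sums -/

/-- The distance of `u` from the multiples of `p`. -/
def circDist (p u : ℤ) : ℤ := min (u % p) (p - u % p)

lemma circDist_add_self (p u : ℤ) : circDist p (u + p) = circDist p u := by simp [circDist]

lemma circDist_le {p : ℤ} (hp : 0 < p) (u k : ℤ) : circDist p u ≤ |u - p * k| := by
  have h1 := Int.emod_nonneg u hp.ne'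
  have h2 := Int.emod_lt_of_pos u hp
  have h3 := Int.emod_add_mul_ediv u p
  have h4 : u - p * k = u % p + p * (u / p - k) := by linear_combination -h3
  rw [h4, circDist]
  rcases le_or_gt 0 (u / p - k) with h | h
  · have := mul_nonneg hp.le h
    exact (min_le_left _ _).trans ((by linarith : u % p ≤ _).trans (le_abs_self _))
  · have : p * (u / p - k) ≤ p * (-1) := mul_le_mul_of_nonneg_left (by omega) hp.le
    exact (min_le_right _ _).trans ((by linarith : p - u % p ≤ _).trans (neg_le_abs _))

lemma exists_circDist_eq (p u : ℤ) : ∃ k, |u - p * k| = circDist p u ∨ p ≤ 0 := by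
  rcases le_or_gt p 0 with hp | hp
  · exact ⟨0, Or.inr hp⟩
  have h1 := Int.emod_nonneg u hp.ne'
  have h2 := Int.emod_lt_of_pos u hp
  have h3 := Int.emod_add_mul_ediv u p
  rcases le_total (u % p) (p - u % p) with h | h
  · refine ⟨u / p, Or.inl ?_⟩
    rw [circDist, min_eq_left h, show u - p * (u / p) = u % p by linear_combination -h3,
      abs_of_nonneg h1]
  · refine ⟨u / p + 1, Or.inl ?_⟩
    rw [circDist, min_eq_right h, show u - p * (u / p + 1) = -(p - u % p) by
      linear_combination -h3, abs_neg, abs_of_nonneg (by linarith)]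

lemma circDist_eq_abs {p u : ℤ} (h : 2 * |u| ≤ p) : circDist p u = |u| := by
  rcases le_or_gt p 0 with hp | hp
  · have h0 := abs_nonneg u
    obtain rfl : p = 0 := by omega
    have : u = 0 := abs_eq_zero.1 (by omega)
    simp [circDist, this]
  refine le_antisymm (by simpa using circDist_le hp u 0) ?_
  obtain ⟨k, hk | hk⟩ := exists_circDist_eq p u
  · rw [← hk]
    rcases eq_or_ne k 0 with rfl | h0
    · simp
    · have h1 : p ≤ |p * k| := by
        rw [abs_mul, abs_of_pos hp]
        exact le_mul_of_one_le_right hp.le (Int.one_le_abs h0)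
      have h2 := abs_sub_abs_le_abs_sub (p * k) u
      rw [abs_sub_comm] at h2
      linarith
  · omega

lemma circDist_neg {p : ℤ} (hp : 0 < p) (u : ℤ) : circDist p (-u) = circDist p u := by
  have key : ∀ u, circDist p (-u) ≤ circDist p u := fun u => by
    obtain ⟨k, hk | hk⟩ := exists_circDist_eq p u
    · rw [← hk, ← abs_neg (u - p * k)]
      refine (circDist_le hp _ (-k)).trans (le_of_eq ?_)
      congr 1; ring
    · omega
  exact le_antisymm (key u) (by simpa using key (-u))

/-- Odd and even multiples of `p` are at least `p` apart. This is the bound for tokens of odd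
winding. -/
lemma le_circDist_add_abs {p : ℤ} (hp : 0 < p) (u c : ℤ) (hc : ¬ (2 : ℤ) ∣ c) :
    p ≤ circDist (2 * p) u + |u - p * c| := by
  obtain ⟨k, hk | hk⟩ := exists_circDist_eq (2 * p) u
  · rw [← hk]
    have h0 : c - 2 * k ≠ 0 := fun h => hc ⟨k, by linarith⟩
    have h1 : p ≤ |p * (c - 2 * k)| := by
      rw [abs_mul, abs_of_pos hp]
      exact le_mul_of_one_le_right hp.le (Int.one_le_abs h0)
    have h2 := abs_sub (u - 2 * p * k) (u - p * c)
    rw [show u - 2 * p * k - (u - p * c) = p * (c - 2 * k) by ring] at h2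
    linarith
  · omega

lemma circDist_eq_abs_of_eq {p u y : ℤ} (k : ℤ) (hu : u = p * k - y) (h1 : -p ≤ 2 * y)
    (h2 : 2 * y ≤ p) : circDist p u = |y| := by
  rw [hu, ← abs_neg, ← circDist_eq_abs (p := p) (by
    rw [abs_neg]; rcases abs_cases y with h | h <;> omega)]
  simp [circDist, sub_eq_add_neg]

lemma two_mul_sum_abs (m : ℕ) :
    2 * ∑ i ∈ Finset.range m, |2 * (i : ℤ) + 1 - m| = (m : ℤ) ^ 2 - m % 2 := by
  induction m using Nat.twoStepInduction with
  | zero => simp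
  | one => simp
  | more m ih _ =>
    rw [Finset.sum_range_succ, Finset.sum_range_succ']
    have h : ∀ i ∈ Finset.range m, |2 * ((i + 1 : ℕ) : ℤ) + 1 - ((m + 2 : ℕ) : ℤ)| =
        |2 * (i : ℤ) + 1 - m| := fun i _ => by congr 1; push_cast; ring
    rw [Finset.sum_congr rfl h]
    have h1 : |2 * ((m + 1 : ℕ) : ℤ) + 1 - ((m + 2 : ℕ) : ℤ)| = m + 1 := by
      rw [abs_of_nonneg] <;> push_cast <;> linarith
    have h2 : |2 * ((0 : ℕ) : ℤ) + 1 - ((m + 2 : ℕ) : ℤ)| = m + 1 := by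
      rw [abs_of_nonpos] <;> push_cast <;> linarith
    rw [h1, h2, mul_add, mul_add, ih]
    have : ((m + 2 : ℕ) : ℤ) % 2 = (m : ℤ) % 2 := by push_cast; omega
    rw [this]; push_cast; ring

lemma sum_reflect_of_even (n : ℕ) {f : ℤ → ℤ} (hf : ∀ u, f (-u) = f u) (V : ℤ) :
    ∑ i ∈ Finset.range n, f (V + (n - 1) - 2 * i) =
      ∑ i ∈ Finset.range n, f (-V + (n - 1) - 2 * i) := by
  rw [← Finset.sum_range_reflect]
  refine Finset.sum_congr rfl fun i hi => ?_
  have := Finset.mem_range.1 hi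
  rw [← hf]; congr 1
  have : ((n - 1 - i : ℕ) : ℤ) = n - 1 - i := by omega
  rw [this]; ring

/-- The sum of the distances from the multiples of `2 * h - 1`, over a full period and one more
point at the largest distance. -/
lemma sum_circDist_even {h : ℕ} (hh : 1 ≤ h) (V : ℤ)
    (hV : V = h - 1 ∨ V = -(h - 1) ∨ V = h ∨ V = -h) :
    ∑ i ∈ Finset.range (2 * h), circDist (2 * h - 1) (V + (2 * h - 1) - 2 * i) = h ^ 2 - 1 := by
  have hp : (0 : ℤ) < 2 * h - 1 := by omega
  have hrefl : ∀ V : ℤ, _ := fun V => sum_reflect_of_even (2 * h) (circDist_neg hp) V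
  push_cast at hrefl
  have hper : ∀ V : ℤ, ∑ i ∈ Finset.range (2 * h),
      circDist (2 * h - 1) (V + (2 * h - 1) + (2 * h - 1) - 2 * i) =
      ∑ i ∈ Finset.range (2 * h), circDist (2 * h - 1) (V + (2 * h - 1) - 2 * i) := fun V =>
    Finset.sum_congr rfl fun i _ => by
      rw [← circDist_add_self _ (V + (2 * h - 1) - 2 * i)]; congr 1; ring
  have base : ∑ i ∈ Finset.range (2 * h),
      circDist (2 * h - 1) ((h - 1 : ℤ) + (2 * h - 1) - 2 * i) = h ^ 2 - 1 := by
    obtain ⟨m, rfl⟩ : ∃ m, h = m + 1 := ⟨h - 1, by omega⟩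
    -- With `p = 2 * h - 1`, the progression is cut according to the nearest multiple of `p`, which
    -- is `p`, `0` and `-p` in turn.
    have e1 : ∀ i ∈ Finset.range (m + 1), circDist (2 * ((m + 1 : ℕ) : ℤ) - 1)
        (((m + 1 : ℕ) : ℤ) - 1 + (2 * ((m + 1 : ℕ) : ℤ) - 1) - 2 * i) =
        |2 * (i : ℤ) + 1 - ((m + 1 : ℕ) : ℤ)| := fun i hi => by
      have := Finset.mem_range.1 hi
      exact circDist_eq_abs_of_eq 1 (by push_cast; ring) (by omega) (by omega)
    have e2 : ∀ i ∈ Finset.range m, circDist (2 * ((m + 1 : ℕ) : ℤ) - 1)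
        (((m + 1 : ℕ) : ℤ) - 1 + (2 * ((m + 1 : ℕ) : ℤ) - 1) - 2 * ((m + 1 + i : ℕ) : ℤ)) =
        |2 * (i : ℤ) + 1 - m| := fun i hi => by
      have := Finset.mem_range.1 hi
      exact circDist_eq_abs_of_eq 0 (by push_cast; ring) (by omega) (by omega)
    have e3 : circDist (2 * ((m + 1 : ℕ) : ℤ) - 1)
        (((m + 1 : ℕ) : ℤ) - 1 + (2 * ((m + 1 : ℕ) : ℤ) - 1) - 2 * ((m + 1 + m : ℕ) : ℤ)) =
        |-(m : ℤ)| :=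
      circDist_eq_abs_of_eq (-1) (by push_cast; ring) (by omega) (by omega)
    rw [show 2 * (m + 1) = m + 1 + m + 1 by ring, Finset.sum_range_succ, Finset.sum_range_add,
      Finset.sum_congr rfl e1, Finset.sum_congr rfl e2, e3, abs_neg, Nat.abs_cast]
    have w1 := two_mul_sum_abs (m + 1)
    have w2 := two_mul_sum_abs m
    have : ((m + 1 : ℕ) : ℤ) % 2 = 1 - (m : ℤ) % 2 := by omega
    rw [this] at w1
    push_cast at *
    linarith
  -- The four values form one orbit: negation is a symmetry, and `h = -(h - 1) + (2 * h - 1)`.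
  rcases hV with rfl | rfl | rfl | rfl
  · exact base
  · rw [← hrefl, base]
  · rw [← base, hrefl (h - 1), ← hper (-(h - 1))]
    refine Finset.sum_congr rfl fun i _ => ?_
    congr 1; ring
  · rw [← base, ← hrefl, hrefl (h - 1), ← hper (-(h - 1))]
    refine Finset.sum_congr rfl fun i _ => ?_
    congr 1; ring

/-- The sum of the distances from the multiples of `2 * h`, over a full period and one more
point at distance `h`. -/
lemma le_sum_circDist_odd {h : ℕ} (hh : 1 ≤ h) (V : ℤ) (hV : V = h ∨ V = -h) :
    (h : ℤ) ^ 2 + h ≤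
      ∑ i ∈ Finset.range (2 * h + 1), circDist (2 * h) (V + 2 * h - 2 * i) := by
  have base : (h : ℤ) ^ 2 + h ≤
      ∑ i ∈ Finset.range (2 * h + 1), circDist (2 * h) ((h : ℤ) + 2 * h - 2 * i) := by
    have e1 : ∀ i ∈ Finset.range (h + 1), circDist (2 * (h : ℤ)) (h + 2 * h - 2 * i) =
        |2 * (i : ℤ) + 1 - ((h + 1 : ℕ) : ℤ)| := fun i hi => by
      have := Finset.mem_range.1 hi
      exact circDist_eq_abs_of_eq 1 (by push_cast; ring) (by omega) (by omega)
    have e2 : ∀ i ∈ Finset.range h, circDist (2 * (h : ℤ))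
        (h + 2 * h - 2 * ((h + 1 + i : ℕ) : ℤ)) =
        |2 * ((i + 1 : ℕ) : ℤ) + 1 - ((h + 1 : ℕ) : ℤ)| := fun i hi => by
      have := Finset.mem_range.1 hi
      exact circDist_eq_abs_of_eq 0 (by push_cast; ring) (by omega) (by omega)
    rw [show 2 * h + 1 = h + 1 + h by ring, Finset.sum_range_add,
      Finset.sum_congr rfl e1, Finset.sum_congr rfl e2]
    have w1 := two_mul_sum_abs (h + 1)
    have w2 := w1
    rw [Finset.sum_range_succ' _ h] at w2
    have w3 : |2 * ((0 : ℕ) : ℤ) + 1 - ((h + 1 : ℕ) : ℤ)| = h := by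
      rw [abs_of_nonpos] <;> push_cast <;> linarith
    rw [w3] at w2
    have : ((h + 1 : ℕ) : ℤ) % 2 ≤ 1 := by omega
    push_cast at *
    linarith
  rcases hV with rfl | rfl
  · exact base
  · have hr := sum_reflect_of_even (2 * h + 1)
      (circDist_neg (p := 2 * (h : ℤ)) (by omega)) h
    push_cast at hr
    simp only [add_sub_cancel_right] at hr
    rwa [← hr]

/-- The analogue of `le_sum_circDist_odd` for the other parity. -/
lemma sum_min_circDist {h : ℕ} (hh : 1 ≤ h) (V : ℤ) (hV : V = h + 1 ∨ V = -(h + 1)) :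
    ∑ i ∈ Finset.range (2 * h + 1), min (circDist (2 * (2 * h)) (V + 2 * h - 2 * i) + 1)
      (2 * h - circDist (2 * (2 * h)) (V + 2 * h - 2 * i)) = (h : ℤ) ^ 2 + 2 * h - h % 2 := by
  have base : ∑ i ∈ Finset.range (2 * h + 1),
      min (circDist (2 * (2 * h)) ((h : ℤ) + 1 + 2 * h - 2 * i) + 1)
      (2 * h - circDist (2 * (2 * h)) ((h : ℤ) + 1 + 2 * h - 2 * i)) =
      (h : ℤ) ^ 2 + 2 * h - h % 2 := by
    have e0 : circDist (2 * (2 * (h : ℤ))) (h + 1 + 2 * h - 2 * ((0 : ℕ) : ℤ)) =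
        |(h : ℤ) - 1| := circDist_eq_abs_of_eq 1 (by push_cast; ring) (by omega) (by omega)
    have e1 : ∀ i ∈ Finset.range h, circDist (2 * (2 * (h : ℤ)))
        (h + 1 + 2 * h - 2 * ((i + 1 : ℕ) : ℤ)) = 2 * h - |2 * (i : ℤ) + 1 - h| :=
        fun i hi => by
      have := Finset.mem_range.1 hi
      rcases le_total (2 * (i : ℤ) + 1 - h) 0 with hle | hle
      · rw [circDist_eq_abs_of_eq (y := h + 1 + 2 * i) 1 (by push_cast; ring) (by omega)
          (by omega), abs_of_nonneg (by omega), abs_of_nonpos hle]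
        ring
      · rw [circDist_eq_abs_of_eq (y := 2 * i + 1 - 3 * h) 0 (by push_cast; ring) (by omega)
          (by omega), abs_of_nonpos (by omega), abs_of_nonneg hle]
        ring
    have e2 : ∀ i ∈ Finset.range h, circDist (2 * (2 * (h : ℤ)))
        (h + 1 + 2 * h - 2 * ((h + i + 1 : ℕ) : ℤ)) = |2 * (i : ℤ) + 1 - h| := fun i hi => by
      have := Finset.mem_range.1 hi
      exact circDist_eq_abs_of_eq 0 (by push_cast; ring) (by omega) (by omega)
    have habs : ∀ i ∈ Finset.range h, |2 * (i : ℤ) + 1 - h| + 1 ≤ h := fun i hi => by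
      have := Finset.mem_range.1 hi
      rcases abs_cases (2 * (i : ℤ) + 1 - h) with h | h <;> omega
    have f1 : ∀ i ∈ Finset.range h,
        min (circDist (2 * (2 * (h : ℤ))) (h + 1 + 2 * h - 2 * ((i + 1 : ℕ) : ℤ)) + 1)
          (2 * h - circDist (2 * (2 * (h : ℤ))) (h + 1 + 2 * h - 2 * ((i + 1 : ℕ) : ℤ))) =
        |2 * (i : ℤ) + 1 - h| := fun i hi => by
      have := habs i hi
      rw [e1 i hi, min_eq_right] <;> linarith
    have f2 : ∀ i ∈ Finset.range h,
        min (circDist (2 * (2 * (h : ℤ))) (h + 1 + 2 * h - 2 * ((h + i + 1 : ℕ) : ℤ)) + 1)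
          (2 * h - circDist (2 * (2 * (h : ℤ)))
            (h + 1 + 2 * h - 2 * ((h + i + 1 : ℕ) : ℤ))) =
        |2 * (i : ℤ) + 1 - h| + 1 := fun i hi => by
      have := habs i hi
      rw [e2 i hi, min_eq_left]; linarith
    rw [Finset.sum_range_succ', two_mul h, Finset.sum_range_add, Finset.sum_congr rfl f1,
      Finset.sum_congr rfl f2, e0, abs_of_nonneg (by omega), min_eq_left (by linarith),
      Finset.sum_add_distrib]
    have w := two_mul_sum_abs h
    simp only [Finset.sum_const, Finset.card_range, nsmul_eq_mul, mul_one]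
    linarith
  rcases hV with rfl | rfl
  · exact base
  · have hr := sum_reflect_of_even (2 * h + 1)
      (f := fun u => min (circDist (2 * (2 * h)) u + 1) (2 * h - circDist (2 * (2 * h)) u))
      (fun u => by rw [circDist_neg (by omega)]) (h + 1)
    push_cast at hr
    simp only [add_sub_cancel_right] at hr
    rw [← hr, base]

/-! ### Winding numbers and the two counting bounds -/

/-- Shifting the tokens by any word does not change a periodic sum, so that it can be computed
from the position of the marker alone. -/
lemma sum_squeeze_run {n : ℕ} (hn : 2 ≤ n) (v : List Letter) (C : ℤ) {f : ℤ → ℤ}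
    (hf : ∀ u, f (u + 2 * (n - 1)) = f u) :
    ∑ i ∈ Finset.range n, f (2 * (squeeze n (run n v (i + 1)) - rot v) - (n + 1 - C)) =
      ∑ i ∈ Finset.range n, f (C - 2 * rot v + (n - 1) - 2 * i) := by
  rw [sum_run hn v (f := fun y => f (2 * (squeeze n y - rot v) - (n + 1 - C))),
    ← Finset.sum_range_reflect]
  · refine Finset.sum_congr rfl fun i hi => ?_
    have := Finset.mem_range.1 hi
    have h : ((n - 1 - i : ℕ) : ℤ) = n - 1 - i := by omega
    rw [h, squeeze_of_mem (by omega) (by omega)]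
    congr 1; ring
  · intro y
    simp only [squeeze_add (show 0 < n by omega)]
    rw [← hf (2 * (squeeze n y - rot v) - _)]
    congr 1; ring

lemma exists_winding {n : ℕ} (w : List Letter)
    (hw : ∀ a : ℤ, (n : ℤ) ∣ run n w a - (1 - a)) :
    ∃ c : ℕ → ℤ, ∀ i : ℕ, run n w (i + 1) = n - i + n * c i := by
  have : ∀ i : ℕ, ∃ k : ℤ, run n w (i + 1) = n - i + n * k := fun i => by
    obtain ⟨k, hk⟩ := hw (i + 1)
    exact ⟨k - 1, by linear_combination hk⟩
  exact ⟨fun i => (this i).choose, fun i => (this i).choose_spec⟩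

/-- The displacements `n - i - (i + 1)` of the bare reflection cancel in the sum, so the total
displacement `n * rot w` is due to the windings. This ties the number of odd windings to the parity
of `rot w`. -/
lemma sum_winding {n : ℕ} (hn : 2 ≤ n) (w : List Letter) (c : ℕ → ℤ)
    (hc : ∀ i : ℕ, run n w (i + 1) = n - i + n * c i) :
    ∑ i ∈ Finset.range n, c i = rot w := by
  have h := sum_run_sub hn w
  have h1 : ∑ i ∈ Finset.range n, ((i : ℤ) + (i + 1 - n)) = 0 := by
    have := Finset.sum_range_reflect (fun i : ℕ => (i : ℤ)) n
    rw [Finset.sum_add_distrib, ← this, ← Finset.sum_add_distrib]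
    refine Finset.sum_eq_zero fun i hi => ?_
    have := Finset.mem_range.1 hi
    omega
  have h2 : ∑ i ∈ Finset.range n, (n * c i - ((i : ℤ) + (i + 1 - n))) = n * rot w := by
    rw [← h]
    exact Finset.sum_congr rfl fun i _ => by rw [hc]; ring
  rw [Finset.sum_sub_distrib, h1, sub_zero, ← Finset.mul_sum] at h2
  exact mul_left_cancel₀ (by omega) h2

/-- Token `i` starts at `i + 1` and ends at `n - i + (n - 1) * c i - rot w` in the turning frame;
`i` itself cancels from the sum of the two. -/
lemma sum_abs_le_moveCount {n : ℕ} (hn : 2 ≤ n) (w : List Letter) (c : ℕ → ℤ)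
    (hc : ∀ i : ℕ, run n w (i + 1) = n - i + n * c i)
    (v u : List Letter) (hvu : w = v ++ u) :
    ∑ i ∈ Finset.range n, |2 * (squeeze n (run n v (i + 1)) - rot v) - (n + 1 - rot w) -
      (n - 1) * c i| ≤ moveCount w := by
  have h := sum_abs_squeeze_run_run hn v u
  rw [← hvu] at h
  refine (Finset.sum_congr rfl fun i hi => ?_).trans_le h
  have := Finset.mem_range.1 hi
  rw [hc, squeeze_add_mul (by omega), squeeze_of_mem (y := n - i) (by omega) (by omega),
    squeeze_of_mem (y := i + 1) (by omega) (by omega)]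
  congr 1; ring

/-- For `i ≠ j` the floor quotient changes by `c j - c i ± 1`, which is odd, hence nonzero, when the
windings have equal parity. The left side counts the ordered pairs of this kind; subtracting `n`
removes the diagonal. -/
lemma sq_add_sq_le_swapCount {n : ℕ} (hn : 2 ≤ n) (w : List Letter) (c : ℕ → ℤ)
    (hc : ∀ i : ℕ, run n w (i + 1) = n - i + n * c i) :
    (∑ i ∈ Finset.range n, (1 - c i % 2)) ^ 2 + (∑ i ∈ Finset.range n, c i % 2) ^ 2 - n ≤
      2 * swapCount w := by
  refine le_trans ?_ (sum_abs_ediv_run hn w)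
  have h1 : (n : ℤ) = ∑ i ∈ Finset.range n, ∑ j ∈ Finset.range n, if i = j then 1 else 0 := by
    rw [Finset.sum_congr rfl fun i hi => by rw [Finset.sum_ite_eq, if_pos hi]]
    simp
  rw [sq, sq, Finset.sum_mul_sum, Finset.sum_mul_sum, ← Finset.sum_add_distrib]
  conv_lhs => rw [h1]
  rw [← Finset.sum_sub_distrib]
  refine Finset.sum_le_sum fun i hi => ?_
  rw [← Finset.sum_add_distrib, ← Finset.sum_sub_distrib]
  refine Finset.sum_le_sum fun j hj => ?_
  have hi' := Finset.mem_range.1 hi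
  have hj' := Finset.mem_range.1 hj
  have key : ∀ x : ℤ, 0 ≤ x → x < n → x / n = 0 := fun x h h' => Int.ediv_eq_zero_of_lt h h'
  have key' : ∀ x : ℤ, x < 0 → -n ≤ x → x / n = -1 := fun x h h' => by
    have e := Int.add_ediv_of_dvd_right (a := x) (dvd_refl (n : ℤ))
    rw [Int.ediv_self (by omega), key (x + n) (by omega) (by omega)] at e
    omega
  have h3 : (run n w (j + 1) - run n w (i + 1)) / (n : ℤ) = ((i : ℤ) - j) / n + (c j - c i) := by
    rw [hc, hc, ← Int.add_mul_ediv_left _ _ (show (n : ℤ) ≠ 0 by omega)]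
    congr 1; ring
  rw [h3]
  have e0 : ∀ x : ℤ, x % 2 = 0 ∨ x % 2 = 1 := by omega
  rcases lt_trichotomy i j with hij | hij | hij
  · rw [key' (i - j) (by omega) (by omega), key (j + 1 - (i + 1)) (by omega) (by omega),
      if_neg hij.ne, sub_zero, sub_zero]
    rcases abs_cases (-1 + (c j - c i)) with h | h <;> rcases e0 (c i) with h' | h' <;>
      rcases e0 (c j) with h'' | h'' <;> simp only [h', h''] <;> omega
  · subst hij
    simp only [sub_self, Int.zero_ediv, if_true, add_zero, abs_zero]
    rcases e0 (c i) with h' | h' <;> simp [h']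
  · rw [key (i - j) (by omega) (by omega), key' (j + 1 - (i + 1)) (by omega) (by omega),
      if_neg hij.ne', sub_zero]
    rcases abs_cases (0 + (c j - c i) - -1) with h | h <;> rcases e0 (c i) with h' | h' <;>
      rcases e0 (c j) with h'' | h'' <;> simp only [h', h''] <;> omega

/-! ### Adding up the bounds for either parity of `n` -/

/-- The length bound for `n = 2 * h`. -/
lemma le_length_even {h : ℕ} (hh : 2 ≤ h) (w : List Letter)
    (hw : ∀ a : ℤ, ((2 * h : ℕ) : ℤ) ∣ run (2 * h) w a - (1 - a))
    (hs : (2 : ℤ) ∣ swapCount w + moveCount w - h * (2 * h - 1)) :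
    (h : ℤ) * (2 * h - 1) ≤ w.length := by
  obtain ⟨c, hc⟩ := exists_winding w hw
  have hN := sq_add_sq_le_swapCount (by omega) w c hc
  obtain ⟨v, u, hvu, hV⟩ : ∃ v u, w = v ++ u ∧
      (rot w - 2 * rot v = h - 1 ∨ rot w - 2 * rot v = -(h - 1) ∨
        rot w - 2 * rot v = h ∨ rot w - 2 * rot v = -h) := by
    rcases Int.emod_two_eq_zero_or_one (rot w - h) with hp | hp
    · obtain ⟨v, u, h1, h2⟩ := exists_append_abs_eq (n := 2 * h) (by omega) w hw h (by omega)
        (by omega) (by omega)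
      exact ⟨v, u, h1, by tauto⟩
    · obtain ⟨v, u, h1, h2⟩ := exists_append_abs_eq (n := 2 * h) (by omega) w hw (h - 1)
        (by omega) (by omega) (by omega)
      exact ⟨v, u, h1, by tauto⟩
  have hM := sum_abs_le_moveCount (by omega) w c hc v u hvu
  have hS := sum_circDist_even (h := h) (by omega) _ hV
  have hT := sum_squeeze_run (n := 2 * h) (by omega) v (rot w)
    (f := circDist (2 * h - 1)) (fun u => by
      rw [two_mul (((2 * h : ℕ) : ℤ) - 1), ← add_assoc]
      push_cast
      rw [circDist_add_self, circDist_add_self])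
  have hle := Finset.sum_le_sum fun i (_ : i ∈ Finset.range (2 * h)) =>
    circDist_le (p := 2 * h - 1) (by omega)
      (2 * (squeeze (2 * h) (run (2 * h) v (i + 1)) - rot v) - ((2 * h : ℕ) + 1 - rot w)) (c i)
  have hadd : ∑ i ∈ Finset.range (2 * h), (1 - c i % 2) =
      2 * h - ∑ i ∈ Finset.range (2 * h), c i % 2 := by simp [Finset.sum_sub_distrib]
  rw [hadd] at hN
  rw [← swapCount_add_moveCount]
  generalize ∑ i ∈ Finset.range (2 * h), c i % 2 = b at hN
  push_cast at *
  have hM' : (h : ℤ) ^ 2 - 1 ≤ moveCount w := by linarith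
  have hN' : (h : ℤ) ^ 2 - h ≤ swapCount w := by nlinarith [sq_nonneg ((h : ℤ) - b)]
  obtain ⟨k, hk⟩ := hs
  -- The bounds `h ^ 2 - 1` and `h ^ 2 - h` fall one short of the claim, and the excess `2 * k` is
  -- even.
  have : -1 ≤ 2 * k := by nlinarith
  have : 0 ≤ k := by omega
  linarith

/-- The length bound for `n = 2 * h + 1`. -/
lemma le_length_odd {h : ℕ} (hh : 2 ≤ h) (w : List Letter)
    (hw : ∀ a : ℤ, ((2 * h + 1 : ℕ) : ℤ) ∣ run (2 * h + 1) w a - (1 - a))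
    (hs : (2 : ℤ) ∣ swapCount w - h) :
    (h : ℤ) * (2 * h + 1) ≤ w.length := by
  obtain ⟨c, hc⟩ := exists_winding w hw
  have hN := sq_add_sq_le_swapCount (by omega) w c hc
  have hadd : ∑ i ∈ Finset.range (2 * h + 1), (1 - c i % 2) =
      2 * h + 1 - ∑ i ∈ Finset.range (2 * h + 1), c i % 2 := by simp [Finset.sum_sub_distrib]
  have hC : (2 : ℤ) ∣ rot w - ∑ i ∈ Finset.range (2 * h + 1), c i % 2 := by
    rw [← sum_winding (by omega) w c hc, ← Finset.sum_sub_distrib]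
    exact Finset.dvd_sum fun i _ => by omega
  have hR := even_moveCount_sub_rot w
  rw [hadd] at hN
  rw [← swapCount_add_moveCount]
  rcases Int.emod_two_eq_zero_or_one (rot w - h) with hp | hp
  · obtain ⟨v, u, hvu, hV⟩ := exists_append_abs_eq (n := 2 * h + 1) (by omega) w hw h (by omega)
      (by omega) (by omega)
    have hM := sum_abs_le_moveCount (by omega) w c hc v u hvu
    have hS := le_sum_circDist_odd (h := h) (by omega) _ hV
    have hT := sum_squeeze_run (n := 2 * h + 1) (by omega) v (rot w)
      (f := circDist (2 * h)) (fun u => by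
        rw [two_mul (((2 * h + 1 : ℕ) : ℤ) - 1), ← add_assoc]
        push_cast
        rw [add_sub_cancel_right, circDist_add_self, circDist_add_self])
    have hle := Finset.sum_le_sum fun i (_ : i ∈ Finset.range (2 * h + 1)) =>
      circDist_le (p := 2 * h) (by omega) (2 * (squeeze (2 * h + 1)
        (run (2 * h + 1) v (i + 1)) - rot v) - ((2 * h + 1 : ℕ) + 1 - rot w)) (c i)
    generalize ∑ i ∈ Finset.range (2 * h + 1), c i % 2 = b at hN
    push_cast at *
    simp only [add_sub_cancel_right] at *
    have hM' : (h : ℤ) ^ 2 + h ≤ moveCount w := by linarith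
    have hN' : (h : ℤ) ^ 2 ≤ swapCount w := by
      have : 0 ≤ ((h : ℤ) - b) * (h + 1 - b) := by
        rcases le_or_gt b h with hb | hb
        · exact mul_nonneg (by linarith) (by linarith)
        · exact mul_nonneg_of_nonpos_of_nonpos (by linarith) (by linarith)
      nlinarith
    linarith
  · obtain ⟨v, u, hvu, hV⟩ := exists_append_abs_eq (n := 2 * h + 1) (by omega) w hw (h + 1)
      (by omega) (by omega) (by omega)
    have hM := sum_abs_le_moveCount (by omega) w c hc v u hvu
    have hS := sum_min_circDist (h := h) (by omega) _ hV
    have hT := sum_squeeze_run (n := 2 * h + 1) (by omega) v (rot w)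
      (f := fun u => min (circDist (2 * (2 * h)) u + 1) (2 * h - circDist (2 * (2 * h)) u))
      (fun u => by
        push_cast
        rw [add_sub_cancel_right, circDist_add_self])
    -- A winding of known parity allows distances modulo `4 * h`: `D` if it is even, `2 * h - D` if
    -- it is odd. Charging `1` for an even winding gives a minimum independent of `c i`, at a cost
    -- that the transposition bound can absorb.
    have hle := Finset.sum_le_sum fun i (_ : i ∈ Finset.range (2 * h + 1)) =>
      (show min (circDist (2 * (2 * h)) (2 * (squeeze (2 * h + 1)
          (run (2 * h + 1) v (i + 1)) - rot v) - ((2 * h + 1 : ℕ) + 1 - rot w)) + 1)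
        (2 * h - circDist (2 * (2 * h)) (2 * (squeeze (2 * h + 1)
          (run (2 * h + 1) v (i + 1)) - rot v) - ((2 * h + 1 : ℕ) + 1 - rot w))) ≤
        |2 * (squeeze (2 * h + 1) (run (2 * h + 1) v (i + 1)) - rot v) -
          ((2 * h + 1 : ℕ) + 1 - rot w) - 2 * h * c i| + (1 - c i % 2) by
        generalize 2 * (squeeze (2 * h + 1) (run (2 * h + 1) v (i + 1)) - rot v) -
          ((2 * h + 1 : ℕ) + 1 - rot w) = x
        rcases Int.emod_two_eq_zero_or_one (c i) with hi | hi
        · refine (min_le_left _ _).trans ?_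
          obtain ⟨k, hk⟩ : ∃ k, c i = 2 * k := ⟨c i / 2, by omega⟩
          have := circDist_le (p := 2 * (2 * h)) (by omega) x k
          rw [hi, sub_zero, hk, show x - 2 * h * (2 * k) = x - 2 * (2 * h) * k by ring]
          linarith
        · refine (min_le_right _ _).trans ?_
          have := le_circDist_add_abs (p := 2 * h) (by omega) x (c i) (by omega)
          rw [hi]
          linarith)
    rw [Finset.sum_add_distrib, hadd] at hle
    generalize ∑ i ∈ Finset.range (2 * h + 1), c i % 2 = b at hN hC hle
    push_cast at *
    simp only [add_sub_cancel_right] at *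
    have hM' : (h : ℤ) ^ 2 + 2 * h - h % 2 - (2 * h + 1 - b) ≤ moveCount w := by linarith
    -- The number `b` of odd windings has the parity of `rot w`, that is, of `h + 1`. In terms of
    -- `t` the two bounds sum to the claim plus `4 * t * (t - 1) - h % 2`.
    obtain ⟨t, ht⟩ : ∃ t, b = h + 1 - 2 * t := ⟨(h + 1 - b) / 2, by omega⟩
    have ht0 : 0 ≤ t * (t - 1) := by
      rcases le_or_gt t 0 with h0 | h0
      · exact mul_nonneg_of_nonpos_of_nonpos h0 (by linarith)
      · exact mul_nonneg h0.le (by linarith)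
    have hsum : (h : ℤ) * (2 * h + 1) - h % 2 ≤ swapCount w + moveCount w := by
      subst ht; nlinarith
    rcases Int.emod_two_eq_zero_or_one (h : ℤ) with h0 | h0
    · rw [h0] at hsum; linarith
    -- For odd `h` the missing unit comes from parity: `swapCount w ≡ h` and `moveCount w ≡ rot w ≡
    -- h + 1`, so the length is odd, like the claimed bound.
    · have h3 : (h : ℤ) * (2 * h + 1) = 2 * (h * h) + h := by ring
      rw [h3] at hsum ⊢
      omega

/-! ### From permutations and walks to words -/

/-- The generator of `S_n` named by a letter. -/
def gen (n : ℕ) (hn : 2 ≤ n) : Letter → Equiv.Perm (Fin n)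
  | .swap => Equiv.swap ⟨0, by omega⟩ ⟨1, by omega⟩
  | .left => finRotate n
  | .right => (finRotate n)⁻¹

/-- The position on the circle below an integer. -/
def toPos {n : ℕ} (hn : 2 ≤ n) (y : ℤ) : Fin n :=
  ⟨(y % n).toNat, by
    have := Int.emod_lt_of_pos y (show (0 : ℤ) < n by omega)
    omega⟩

lemma toPos_eq_iff {n : ℕ} (hn : 2 ≤ n) (y : ℤ) (i : Fin n) :
    toPos hn y = i ↔ (n : ℤ) ∣ y - (i : ℕ) := by
  have h0 := Int.emod_nonneg y (show (n : ℤ) ≠ 0 by omega)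
  have h1 : ((i : ℕ) : ℤ) % n = (i : ℕ) :=
    Int.emod_eq_of_lt (by omega) (by exact_mod_cast i.2)
  rw [Int.dvd_iff_emod_eq_zero, ← Int.emod_eq_emod_iff_emod_sub_eq_zero, h1, Fin.ext_iff, toPos]
  dsimp only
  omega

lemma dvd_sub_toPos {n : ℕ} (hn : 2 ≤ n) (y : ℤ) : (n : ℤ) ∣ y - (toPos hn y : ℕ) :=
  (toPos_eq_iff hn y _).1 rfl

lemma finRotate_toPos {n : ℕ} (hn : 2 ≤ n) (y : ℤ) :
    finRotate n (toPos hn y) = toPos hn (y + 1) := by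
  have h := dvd_sub_toPos hn y
  symm
  rw [toPos_eq_iff]
  obtain ⟨m, rfl⟩ : ∃ m, n = m + 1 := ⟨n - 1, by omega⟩
  rw [coe_finRotate]
  split_ifs with hl
  · rw [hl, Fin.val_last] at h
    rw [show y + 1 - ((0 : ℕ) : ℤ) = y - (m : ℕ) + ((m + 1 : ℕ) : ℤ) by push_cast; ring]
    exact dvd_add h (dvd_refl _)
  · rwa [show y + 1 - ((toPos hn y + 1 : ℕ) : ℤ) = y - (toPos hn y : ℕ) by push_cast; ring]

/-- Right multiplication by `g` puts at place `i` the token that was at `g i`, so places move by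
`g⁻¹`. Hence `finRotate` corresponds to `y - 1`. -/
lemma gen_toPos_act {n : ℕ} (hn : 2 ≤ n) (l : Letter) (y : ℤ) :
    gen n hn l (toPos hn (act n l y)) = toPos hn y := by
  cases l
  · simp only [gen, act]
    split_ifs with h0 h1
    · rw [(toPos_eq_iff hn (y + 1) ⟨1, by omega⟩).2 (by simpa using h0), Equiv.swap_apply_right,
        (toPos_eq_iff hn y ⟨0, by omega⟩).2 (by simpa using h0)]
    · rw [(toPos_eq_iff hn (y - 1) ⟨0, by omega⟩).2 (by simpa using h1), Equiv.swap_apply_left,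
        (toPos_eq_iff hn y ⟨1, by omega⟩).2 (by simpa using h1)]
    · refine Equiv.swap_apply_of_ne_of_ne (fun h => h0 ?_) (fun h => h1 ?_)
      · simpa using (toPos_eq_iff hn _ _).1 h
      · simpa using (toPos_eq_iff hn _ _).1 h
  · rw [gen, act, finRotate_toPos, sub_add_cancel]
  · rw [gen, act, ← finRotate_toPos, ← Equiv.Perm.mul_apply, inv_mul_cancel, Equiv.Perm.one_apply]

lemma prod_toPos_run {n : ℕ} (hn : 2 ≤ n) (w : List Letter) (y : ℤ) :
    (w.map (gen n hn)).prod (toPos hn (run n w y)) = toPos hn y := by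
  induction w generalizing y with
  | nil => rfl
  | cons l w ih =>
    rw [List.map_cons, List.prod_cons, Equiv.Perm.mul_apply, run, ih, gen_toPos_act]

lemma sign_prod {n : ℕ} (hn : 2 ≤ n) (w : List Letter) :
    Equiv.Perm.sign (w.map (gen n hn)).prod =
      (swapCount w + (n - 1 : ℤ) * moveCount w).negOnePow := by
  induction w with
  | nil => simp
  | cons l w ih =>
    have hl : Equiv.Perm.sign (gen n hn l) = (l.swaps + (n - 1 : ℤ) * |l.shift|).negOnePow := by
      have hr : Equiv.Perm.sign (finRotate n) = (n - 1 : ℤ).negOnePow := by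
        rw [sign_finRotate, show (n : ℤ) - 1 = ((n - 1 : ℕ) : ℤ) by omega,
          Int.negOnePow_def, zpow_natCast]
      cases l
      · rw [gen, Equiv.Perm.sign_swap (by simp)]; simp [Letter.swaps, Letter.shift]
      · simp [gen, hr, Letter.swaps, Letter.shift]
      · simp [gen, hr, Letter.swaps, Letter.shift]
    rw [List.map_cons, List.prod_cons, Equiv.Perm.sign_mul, ih, hl, ← Int.negOnePow_add,
      swapCount_cons, moveCount_cons]
    congr 1; ring

/-- The permutation that sends the position `i` to the position `1 - i`. -/
def reversal (n : ℕ) : Equiv.Perm (Fin n) := finRotate n * finRotate n * Fin.revPerm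

lemma reversal_toPos {n : ℕ} (hn : 2 ≤ n) (a : ℤ) :
    reversal n (toPos hn (1 - a)) = toPos hn a := by
  have h : Fin.revPerm (toPos hn (1 - a)) = toPos hn (a - 2) := by
    symm
    rw [toPos_eq_iff, Fin.revPerm_apply, Fin.val_rev]
    have h := dvd_sub_toPos hn (1 - a)
    have hlt := (toPos hn (1 - a)).2
    have : ((n - ((toPos hn (1 - a) : ℕ) + 1) : ℕ) : ℤ) = n - (toPos hn (1 - a) : ℕ) - 1 := by
      omega
    rw [this, show a - 2 - (n - ((toPos hn (1 - a) : ℕ) : ℤ) - 1) =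
      -(1 - a - (toPos hn (1 - a) : ℕ)) - n by ring]
    exact dvd_sub h.neg_right (dvd_refl _)
  rw [reversal, Equiv.Perm.mul_apply, Equiv.Perm.mul_apply, h, finRotate_toPos, finRotate_toPos]
  congr 1; ring

/-- The two rotations cancel in the sign, and `Fin.revPerm` inverts every pair. -/
lemma sign_reversal (n : ℕ) :
    Equiv.Perm.sign (reversal n) = ((n * (n - 1) / 2 : ℕ) : ℤ).negOnePow := by
  have h : Equiv.Perm.sign (Fin.revPerm : Equiv.Perm (Fin n)) = (-1) ^ (n * (n - 1) / 2) := by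
    rw [Equiv.Perm.sign_eq_prod_prod_Ioi]
    have : ∀ i : Fin n, ∏ j ∈ Finset.Ioi i,
        (if Fin.revPerm i < Fin.revPerm j then (1 : ℤˣ) else -1) = (-1) ^ (n - 1 - (i : ℕ)) :=
        fun i => by
      rw [Finset.prod_congr rfl fun j hj => if_neg (by
        have := Finset.mem_Ioi.1 hj
        simpa using this.le), Finset.prod_const, Fin.card_Ioi]
    rw [Finset.prod_congr rfl fun i _ => this i, Finset.prod_pow_eq_pow_sum,
      Fin.sum_univ_eq_sum_range (fun i => n - 1 - i), Finset.sum_range_reflect (fun i => i),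
      Finset.sum_range_id]
  rw [reversal, Equiv.Perm.sign_mul, Equiv.Perm.sign_mul, Int.units_mul_self, one_mul, h,
    Int.negOnePow_def, zpow_natCast]

lemma mem_lrxGenerators_iff {n : ℕ} (hn : 2 ≤ n) (g : Equiv.Perm (Fin n)) :
    g ∈ lrxGenerators n hn ↔ ∃ l, gen n hn l = g := by
  constructor
  · rintro (rfl | rfl | rfl)
    exacts [⟨.swap, rfl⟩, ⟨.left, rfl⟩, ⟨.right, rfl⟩]
  · rintro ⟨l, rfl⟩
    cases l <;> simp [lrxGenerators, gen]

lemma exists_gen_eq_inv {n : ℕ} (hn : 2 ≤ n) (l : Letter) :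
    ∃ l', gen n hn l' = (gen n hn l)⁻¹ := by
  cases l
  exacts [⟨.swap, by simp [gen]⟩, ⟨.right, rfl⟩, ⟨.left, by simp [gen]⟩]

/-- The generators are closed under inversion, so an edge traversed in either direction is a right
multiplication by a letter. -/
lemma exists_word {n : ℕ} (hn : 2 ≤ n) {p q : Equiv.Perm (Fin n)}
    (W : (lrxCayleyGraph n hn).Walk p q) :
    ∃ w : List Letter, w.length = W.length ∧ q = p * (w.map (gen n hn)).prod := by
  induction W with
  | nil => exact ⟨[], by simp⟩
  | @cons p p' q h W ih =>
    obtain ⟨w, hw, rfl⟩ := ih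
    obtain ⟨l, hl⟩ : ∃ l, p' = p * gen n hn l := by
      obtain ⟨-, g, hg, h⟩ := (SimpleGraph.mulCayley_adj' _ _ _).1 h
      obtain ⟨l, rfl⟩ := (mem_lrxGenerators_iff hn g).1 hg
      rcases h with h | h
      · exact ⟨l, h.symm⟩
      · obtain ⟨l', hl'⟩ := exists_gen_eq_inv hn l
        exact ⟨l', by rw [hl', h, mul_inv_cancel_right]⟩
    exact ⟨l :: w, by simp [hw], by simp [hl, mul_assoc]⟩

lemma connected_lrxCayleyGraph {n : ℕ} (hn : 2 ≤ n) : (lrxCayleyGraph n hn).Connected := by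
  have hcl : Subgroup.closure (lrxGenerators n hn) = ⊤ := by
    have hc := Equiv.Perm.closure_cycle_adjacent_swap (isCycle_finRotate_of_le hn)
      (support_finRotate_of_le hn) ⟨0, by omega⟩
    have h1 : finRotate n ⟨0, by omega⟩ = ⟨1, by omega⟩ := by
      obtain ⟨m, rfl⟩ : ∃ m, n = m + 1 := ⟨n - 1, by omega⟩
      exact finRotate_of_lt (by omega)
    rw [h1] at hc
    refine top_le_iff.1 (hc ▸ Subgroup.closure_mono ?_)
    rintro g (rfl | rfl) <;> simp [lrxGenerators]
  have step : ∀ g ∈ Subgroup.closure (lrxGenerators n hn), ∀ u,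
      (lrxCayleyGraph n hn).Reachable u (u * g) := by
    intro g hg
    induction hg using Subgroup.closure_induction with
    | mem g hg =>
      intro u
      -- Adjacency excludes loops, so a trivial step is treated apart.
      by_cases h : u = u * g
      · rw [← h]
      · exact ((SimpleGraph.mulCayley_adj' _ _ _).2 ⟨h, g, hg, Or.inl rfl⟩).reachable
    | one => intro u; rw [mul_one]
    | mul x y _ _ hx hy => intro u; rw [← mul_assoc]; exact (hx u).trans (hy _)
    | inv x _ hx => intro u; simpa using (hx (u * x⁻¹)).symm
  refine ⟨fun u v => ?_⟩
  simpa using step (u⁻¹ * v) (by rw [hcl]; trivial) u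

lemma le_length_of_prod_eq_reversal {n : ℕ} (hn2 : 2 ≤ n) (hn : 4 ≤ n) (w : List Letter)
    (hw : (w.map (gen n hn2)).prod = reversal n) :
    (n : ℤ) * (n - 1) ≤ 2 * w.length := by
  have hend : ∀ a : ℤ, (n : ℤ) ∣ run n w a - (1 - a) := fun a => by
    have h : toPos hn2 (run n w a) = toPos hn2 (1 - a) := by
      apply (reversal n).injective
      rw [reversal_toPos, ← hw, prod_toPos_run]
    have h1 := (toPos_eq_iff hn2 _ _).1 h
    simpa using dvd_sub h1 (dvd_sub_toPos hn2 (1 - a))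
  have hsign := sign_prod hn2 w
  rw [hw, sign_reversal, Int.negOnePow_eq_iff, even_iff_two_dvd] at hsign
  obtain ⟨h, rfl | rfl⟩ := n.even_or_odd'
  · have hk : (2 * h * (2 * h - 1) / 2 : ℕ) = h * (2 * h - 1) := by
      rw [mul_assoc, Nat.mul_div_cancel_left _ two_pos]
    have hk' : ((h * (2 * h - 1) : ℕ) : ℤ) = h * (2 * h - 1) := by
      push_cast [show 1 ≤ 2 * h by omega]; ring
    rw [hk, hk'] at hsign
    have := le_length_even (h := h) (by omega) w hend (by
      obtain ⟨k, hk⟩ := hsign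
      push_cast at hk
      exact ⟨-k - (h - 1) * moveCount w, by linear_combination -hk⟩)
    push_cast
    linarith
  · have hk : ((2 * h + 1) * (2 * h + 1 - 1) / 2 : ℕ) = h * (2 * h + 1) := by
      rw [Nat.add_sub_cancel, show (2 * h + 1) * (2 * h) = 2 * (h * (2 * h + 1)) by ring,
        Nat.mul_div_cancel_left _ two_pos]
    rw [hk] at hsign
    have := le_length_odd (h := h) (by omega) w hend (by
      obtain ⟨k, hk⟩ := hsign
      push_cast at hk
      exact ⟨-k - h * moveCount w + h * h, by linear_combination -hk⟩)
    push_cast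
    linarith

end LRX

/-- The natural-number diameter `SimpleGraph.diam` is `0` for a disconnected graph, so the bound
(positive for `n ≥ 4`) includes that the graph is connected. -/
theorem theorem2 (n : ℕ) (hn : 4 ≤ n) :
    (n : ℝ) * ((n : ℝ) - 1) / 2 ≤ ((lrxCayleyGraph n (by omega)).diam : ℝ) := by
  have hn2 : 2 ≤ n := by omega
  have hconn := LRX.connected_lrxCayleyGraph hn2
  obtain ⟨W, hW⟩ := hconn.exists_walk_length_eq_dist 1 (LRX.reversal n)
  obtain ⟨w, hw, hprod⟩ := LRX.exists_word hn2 W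
  have h1 := LRX.le_length_of_prod_eq_reversal hn2 hn w (by rw [hprod, one_mul])
  have h2 := SimpleGraph.dist_le_diam (SimpleGraph.connected_iff_ediam_ne_top.1 hconn)
    (u := 1) (v := LRX.reversal n)
  rw [hw, hW] at h1
  have h3 : (n : ℝ) * (n - 1) ≤ 2 * ((lrxCayleyGraph n hn2).dist 1 (LRX.reversal n) : ℝ) := by
    exact_mod_cast h1
  have h4 : ((lrxCayleyGraph n hn2).dist 1 (LRX.reversal n) : ℝ) ≤
    (lrxCayleyGraph n hn2).diam := by exact_mod_cast h2
  linarith
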